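/- Let $\Gamma$ be a finitely generated word hyperbolic group with boundary at infinity $\partial_\infty\Gamma$, and let $\hat\Gamma$ be its flow space: a proper hyperbolic metric space with an action of $\Gamma\times(\mathbb R\rtimes\mathbb Z/2)$ such that $\Gamma\times\mathbb Z/2$ acts by isometries, the $\Gamma$-orbit maps $\Gamma\to\hat\Gamma$ are quasi-isometries (so $\partial_\infty\hat\Gamma\cong\partial_\infty\Gamma$), the $\mathbb R$-action $\phi_t$ is free, its orbit maps are quasi-isometric embeddings, and sending an $\mathbb R$-orbit to its pair of end points $(\tau^+,\tau^-)$ is a homeomorphism from $\hat\Gamma/\mathbb R$ onto the space of pairs of distinct points of $\partial_\infty\hat\Gamma$. Let $G$ be a connected semisimple affine algebraic group over $\mathbb C$. A closed subgroup of $G$ is parabolic if it contains a Borel subgroup, and two parabolic subgroups $P^+,P^-$ are opposite if $P^+\cap P^-$ is a Levi subgroup of both. Write $\mathcal F^\pm=G/P^\pm$; a pair in $\mathcal F^+\times\mathcal F^-$ is transverse if it lies in the $G$-orbit of the pair of base points. A representation $\rho:\Gamma\to G$ is $(P^+,P^-)$-Anosov with Anosov maps $\xi^\pm:\partial_\infty\Gamma\to\mathcal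 F^\pm$ if $\xi^\pm$ are continuous and $\rho$-equivariant, $(\xi^+(t),\xi^-(s))$ is transverse for all $t\ne s$, and there are continuous $\rho$-equivariant families of norms $\|\cdot\|_{\hat m}$ on $T_{\xi^+(\tau^+(\hat m))}\mathcal F^+$ and on $T_{\xi^-(\tau^-(\hat m))}\mathcal F^-$ ($\hat m\in\hat\Gamma$) and, for each of them, constants $A,a>0$ such that for all $t\ge0$, all $\hat m$ and all tangent vectors $e$, $\|e\|_{\phi_{-t}(\hat m)}\le Ae^{-at}\|e\|_{\hat m}$ in the first case and $\|e\|_{\phi_{t}(\hat m)}\le Ae^{-at}\|e\|_{\hat m}$ in the second. A pair of maps $\xi^\pm:\partial_\infty\Gamma\to\mathcal F^\pm$ is compatible if $\mathrm{Stab}(\xi^+(t))\cap\mathrm{Stab}(\xi^-(t))$ is parabolic for every $t$ and $(\xi^+(t),\xi^-(s))$ is transverse for all $t\neq s$. For $g\in G$ let $g\rho g^{-1}(\gamma)=g\rho(\gamma)g^{-1}$ and $(g\xi^\pm)(t)=g\,\xi^\pm(t)$. (1) Let $n\ge2$, let $\mathbb C^n=D\oplus H$ with $\dim D=1$, and let $Q^+=\mathrm{Stab}(D)$,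 $Q^-=\mathrm{Stab}(H)$ in $\mathrm{SL}(n,\mathbb C)$. If $\rho:\Gamma\to\mathrm{SL}(n,\mathbb C)$ is irreducible (its image lies in no proper parabolic subgroup) and $(Q^+,Q^-)$-Anosov with Anosov maps $\xi^\pm$, then for every $g\in\mathrm{SL}(n,\mathbb C)$ the representation $g\rho g^{-1}$ is irreducible and $(Q^+,Q^-)$-Anosov with Anosov maps $g\xi^\pm$. Hence $\mathrm{SL}(n,\mathbb C)$ acts by conjugation on the set of irreducible $(Q^+,Q^-)$-Anosov representations. (2) Let $(P^+,P^-)$ be a pair of opposite parabolic subgroups of $G$, let $\rho:\Gamma\to G$ be $(P^+,P^-)$-Anosov with Anosov maps $\xi^\pm$, and let $g\in G$. (a) The maps $g\xi^\pm$ are continuous and $g\rho g^{-1}$-equivariant, $(g\xi^+(t),g\xi^-(s))$ is transverse for all $t\ne s$, and if the pair $\xi^\pm$ is compatible, then so is the pair $g\xi^\pm$. (b) If $\rho$ is Zariski dense, then $g\rho g^{-1}$ is Zariski dense and $(P^+,P^-)$-Anosov with Anosov maps $g\xi^\pm$. Hence $G$ acts by conjugation on the set of Zariski-dense $(P^+,P^-)$-Anosov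 representations. -/

import Mathlib

open Filter Topology

noncomputable section

namespace AnosovRep

/-! ### Coarse geometry: word metrics, Gromov hyperbolicity, Gromov boundary -/

section Coarse

variable {X Y : Type*}

/-- The Gromov product `(x | y)_o` for a distance function `d`. -/
def gromovProd (d : X → X → ℝ) (o x y : X) : ℝ := (d o x + d o y - d x y) / 2

/-- Gromov hyperbolicity (four point condition). -/
def IsGromovHyperbolic (d : X → X → ℝ) : Prop :=
  ∃ δ : ℝ, ∀ o x y z : X,
    min (gromovProd d o x y) (gromovProd d o y z) - δ ≤ gromovProd d o x z

/-- `f` is a quasi-isometric embedding from `(X, dX)` to `(Y, dY)`. -/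
def IsQIEmbedding (dX : X → X → ℝ) (dY : Y → Y → ℝ) (f : X → Y) : Prop :=
  ∃ K C : ℝ, 1 ≤ K ∧ 0 ≤ C ∧ ∀ x y : X,
    K⁻¹ * dX x y - C ≤ dY (f x) (f y) ∧ dY (f x) (f y) ≤ K * dX x y + C

/-- `f` is a quasi-isometry: a quasi-isometric embedding with coarsely dense image. -/
def IsQuasiIsometry (dX : X → X → ℝ) (dY : Y → Y → ℝ) (f : X → Y) : Prop :=
  IsQIEmbedding dX dY f ∧ ∃ R : ℝ, ∀ y : Y, ∃ x : X, dY (f x) y ≤ R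

/-- A sequence converges at infinity if `(x_i | x_j)_o → ∞` as `i, j → ∞`. Changing the base point
changes the Gromov product by a bounded amount, so it does not matter which `o` is used. -/
def IsGromovSeq (d : X → X → ℝ) (x : ℕ → X) : Prop :=
  ∀ o : X, Tendsto (fun p : ℕ × ℕ => gromovProd d o (x p.1) (x p.2)) atTop atTop

/-- Sequences converging at infinity. -/
def GromovSeq (d : X → X → ℝ) : Type _ := {x : ℕ → X // IsGromovSeq d x}

/-- Two sequences converging at infinity have the same limit if `(x_i | y_j)_o → ∞`
as `i, j → ∞`. -/
def GromovSeq.Rel (d : X → X → ℝ) (x y : GromovSeq d) : Prop :=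
  ∀ o : X, Tendsto (fun p : ℕ × ℕ => gromovProd d o (x.1 p.1) (y.1 p.2)) atTop atTop

/-- The boundary at infinity of `(X, d)`: sequences converging at infinity, modulo having the same
limit (for hyperbolic `d` the relation is an equivalence relation). -/
def GromovBoundary (d : X → X → ℝ) : Type _ := Quot (GromovSeq.Rel d)

/-- The boundary point defined by a sequence converging at infinity. -/
def GromovBoundary.mk (d : X → X → ℝ) (x : ℕ → X) (hx : IsGromovSeq d x) : GromovBoundary d :=
  Quot.mk _ ⟨x, hx⟩

/-- The standard neighbourhood `U(p, r)` of a boundary point: those `q` for which there are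
sequences `x_i → p`, `y_j → q` with `(x_i | y_j)_o ≥ r` for all large `i, j`. -/
def GromovBoundary.nhd (d : X → X → ℝ) (o : X) (p : GromovBoundary d) (r : ℝ) :
    Set (GromovBoundary d) :=
  {q | ∃ x y : GromovSeq d, Quot.mk _ x = p ∧ Quot.mk _ y = q ∧
    ∃ k : ℕ, ∀ i ≥ k, ∀ j ≥ k, r ≤ gromovProd d o (x.1 i) (y.1 j)}

theorem GromovBoundary.nhd_anti (d : X → X → ℝ) (o : X) (p : GromovBoundary d) {r s : ℝ}
    (h : r ≤ s) : nhd d o p s ⊆ nhd d o p r := by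
  rintro q ⟨x, y, hx, hy, k, hk⟩
  exact ⟨x, y, hx, hy, k, fun i hi j hj => h.trans (hk i hi j hj)⟩

/-- The usual topology of the boundary: `V` is open iff it contains some `U(p, r)` for each of its
points `p`. -/
instance GromovBoundary.topology (d : X → X → ℝ) : TopologicalSpace (GromovBoundary d) where
  IsOpen V := ∀ p ∈ V, ∀ o : X, ∃ r : ℝ, nhd d o p r ⊆ V
  isOpen_univ := fun _ _ _ => ⟨0, Set.subset_univ _⟩
  isOpen_inter := by
    intro s t hs ht p hp o
    obtain ⟨a, ha⟩ := hs p hp.1 o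
    obtain ⟨b, hb⟩ := ht p hp.2 o
    exact ⟨max a b, fun q hq => ⟨ha (nhd_anti d o p (le_max_left a b) hq),
      hb (nhd_anti d o p (le_max_right a b) hq)⟩⟩
  isOpen_sUnion := by
    intro S hS p hp o
    obtain ⟨t, htS, hpt⟩ := hp
    obtain ⟨r, hr⟩ := hS t htS p hpt o
    exact ⟨r, fun q hq => ⟨t, htS, hr hq⟩⟩

/-- The space of pairs of distinct points. -/
def DistinctPairs (B : Type*) : Type _ := {p : B × B // p.1 ≠ p.2}

instance (B : Type*) [TopologicalSpace B] : TopologicalSpace (DistinctPairs B) :=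
  inferInstanceAs (TopologicalSpace {p : B × B // p.1 ≠ p.2})

end Coarse

section WordMetric

variable {Γ : Type*} [Group Γ]

/-- The word length of `g` with respect to `S`. -/
def wordLength (S : Finset Γ) (g : Γ) : ℕ :=
  sInf {n | ∃ l : List Γ, l.length = n ∧ (∀ s ∈ l, s ∈ S ∨ s⁻¹ ∈ S) ∧ l.prod = g}

/-- The left invariant word metric with respect to `S`. -/
def wordDist (S : Finset Γ) (g h : Γ) : ℝ := wordLength S (g⁻¹ * h)

/-- `S` is a finite generating set of `Γ` whose word metric is Gromov hyperbolic; thus `Γ` is a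
finitely generated word hyperbolic group. -/
def IsHyperbolicGroup (S : Finset Γ) : Prop :=
  Subgroup.closure (S : Set Γ) = ⊤ ∧ IsGromovHyperbolic (wordDist S)

/-- The boundary at infinity of `Γ`. -/
abbrev Bdry (S : Finset Γ) : Type _ := GromovBoundary (wordDist S)

theorem gromovProd_smul (S : Finset Γ) (γ o x y : Γ) :
    gromovProd (wordDist S) o (γ * x) (γ * y) = gromovProd (wordDist S) (γ⁻¹ * o) x y := by
  simp only [gromovProd, wordDist, mul_inv_rev, inv_inv, mul_assoc, inv_mul_cancel_left]

/-- The action of `Γ` on its boundary induced by left multiplication. -/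
instance (S : Finset Γ) : MulAction Γ (Bdry S) where
  smul γ := Quot.map
    (fun x => ⟨fun i => γ * x.1 i, fun o => by
      simpa only [gromovProd_smul] using x.2 (γ⁻¹ * o)⟩)
    (fun x y h o => by simpa only [gromovProd_smul] using h (γ⁻¹ * o))
  one_smul := by
    rintro ⟨x⟩
    exact congrArg (Quot.mk _) (Subtype.ext (funext fun i => one_mul _))
  mul_smul := by
    rintro a b ⟨x⟩
    exact congrArg (Quot.mk _) (Subtype.ext (funext fun i => mul_assoc _ _ _))

end WordMetric

/-! ### The flow space of a hyperbolic group -/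

section FlowSpace

variable {Γ : Type*} [Group Γ]

/-- `M` is the flow space `Γ̂` of the hyperbolic group `Γ`: a proper hyperbolic metric space with an
action of `Γ × (ℝ ⋊ ℤ/2)` such that `Γ × ℤ/2` acts by isometries, the orbit maps of `Γ` are
quasi-isometries (hence identify `∂Γ` with `∂M`), the `ℝ`-action is free, its orbit maps
are quasi-isometric embeddings, and sending an `ℝ`-orbit to its two end points is a
homeomorphism from `M / ℝ` onto the space of pairs of distinct points of `∂M`. Such a space exists
and is unique up to a `Γ × ℤ/2`-equivariant quasi-isometry mapping `ℝ`-orbits to `ℝ`-orbits. -/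
structure FlowSpace (S : Finset Γ) (M : Type*) [MetricSpace M] [ProperSpace M] [MulAction Γ M] where
  hyperbolic : IsGromovHyperbolic (dist : M → M → ℝ)
  isometry_smul : ∀ γ : Γ, Isometry (fun m : M => γ • m)
  /-- the action of `ℝ` -/
  flow : Flow ℝ M
  /-- the action of the generator of `ℤ/2` -/
  flip : M → M
  isometry_flip : Isometry flip
  flip_flip : ∀ m, flip (flip m) = m
  flip_smul : ∀ (γ : Γ) (m : M), flip (γ • m) = γ • flip m
  flip_flow : ∀ (t : ℝ) (m : M), flip (flow t m) = flow (-t) (flip m)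
  flow_smul : ∀ (t : ℝ) (γ : Γ) (m : M), flow t (γ • m) = γ • flow t m
  orbit_quasiIsometry : ∀ m : M, IsQuasiIsometry (wordDist S) dist (fun γ : Γ => γ • m)
  /-- the identification of the boundaries induced by the orbit maps of `Γ` -/
  bdry : Bdry S ≃ₜ GromovBoundary (dist : M → M → ℝ)
  bdry_mk : ∀ (x : ℕ → Γ) (hx : IsGromovSeq (wordDist S) x) (m : M),
    ∃ h : IsGromovSeq (dist : M → M → ℝ) (fun i => x i • m),
      bdry (GromovBoundary.mk _ x hx) = GromovBoundary.mk _ _ h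
  flow_free : ∀ (t : ℝ) (m : M), flow t m = m → t = 0
  flow_qiEmbedding : ∀ m : M, IsQIEmbedding (dist : ℝ → ℝ → ℝ) dist (fun t : ℝ => flow t m)
  /-- the homeomorphism from `M / ℝ` to the space of pairs of distinct points of `∂M` -/
  ends : Quot (fun m m' : M => ∃ t : ℝ, flow t m = m') ≃ₜ
    DistinctPairs (GromovBoundary (dist : M → M → ℝ))
  ends_fst : ∀ (m : M) (s : ℕ → ℝ), Tendsto s atTop atTop →
    ∃ h : IsGromovSeq (dist : M → M → ℝ) (fun i => flow (s i) m),
      (ends (Quot.mk _ m)).1.1 = GromovBoundary.mk _ _ h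
  ends_snd : ∀ (m : M) (s : ℕ → ℝ), Tendsto s atTop atBot →
    ∃ h : IsGromovSeq (dist : M → M → ℝ) (fun i => flow (s i) m),
      (ends (Quot.mk _ m)).1.2 = GromovBoundary.mk _ _ h

variable {S : Finset Γ} {M : Type*} [MetricSpace M] [ProperSpace M] [MulAction Γ M]

/-- The forward end point in `∂Γ` of the orbit of `m`. -/
def FlowSpace.tauPlus (Φ : FlowSpace S M) (m : M) : Bdry S :=
  Φ.bdry.symm (Φ.ends (Quot.mk _ m)).1.1

/-- The backward end point in `∂Γ` of the orbit of `m`. -/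
def FlowSpace.tauMinus (Φ : FlowSpace S M) (m : M) : Bdry S :=
  Φ.bdry.symm (Φ.ends (Quot.mk _ m)).1.2

end FlowSpace

/-! ### Linear algebraic groups over `ℂ`, as Zariski closed subgroups of `GL_N(ℂ)` -/

section Algebraic

variable {N : ℕ}

/-- The Zariski closure in `GL_N(ℂ)`: the common zeros of all polynomials in the matrix
entries that vanish on `A`. -/
def zariskiClosure (A : Set (GL (Fin N) ℂ)) : Set (GL (Fin N) ℂ) :=
  {g | ∀ f : MvPolynomial (Fin N × Fin N) ℂ,
    (∀ a ∈ A, MvPolynomial.eval (fun p => a.1 p.1 p.2) f = 0) →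
      MvPolynomial.eval (fun p => g.1 p.1 p.2) f = 0}

/-- Zariski closed subsets of `GL_N(ℂ)`. -/
def IsZariskiClosed (A : Set (GL (Fin N) ℂ)) : Prop := zariskiClosure A ⊆ A

/-- Connectedness in the Zariski topology. -/
def IsZariskiConnected (H : Subgroup (GL (Fin N) ℂ)) : Prop :=
  ∀ A B : Set (GL (Fin N) ℂ), IsZariskiClosed A → IsZariskiClosed B →
    (H : Set (GL (Fin N) ℂ)) ⊆ A ∪ B → (H : Set (GL (Fin N) ℂ)) ∩ (A ∩ B) = ∅ →
      (H : Set (GL (Fin N) ℂ)) ⊆ A ∨ (H : Set (GL (Fin N) ℂ)) ⊆ B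

/-- `H` is a closed connected subgroup of `G`. -/
def IsClosedConnectedIn (G H : Subgroup (GL (Fin N) ℂ)) : Prop :=
  H ≤ G ∧ IsZariskiClosed (H : Set (GL (Fin N) ℂ)) ∧ IsZariskiConnected H

/-- `G` is a connected semisimple algebraic group: closed, connected, and without nontrivial closed
connected solvable normal subgroups. -/
def IsConnectedSemisimple (G : Subgroup (GL (Fin N) ℂ)) : Prop :=
  IsZariskiClosed (G : Set (GL (Fin N) ℂ)) ∧ IsZariskiConnected G ∧
    ∀ R : Subgroup (GL (Fin N) ℂ), IsClosedConnectedIn G R → (R.subgroupOf G).Normal →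
      Group.IsSolvable R → R = ⊥

/-- Borel subgroups of `G`: the maximal closed connected solvable subgroups. -/
def IsBorel (G B : Subgroup (GL (Fin N) ℂ)) : Prop :=
  Maximal (fun B' => IsClosedConnectedIn G B' ∧ Group.IsSolvable B') B

/-- Parabolic subgroups of `G`: the closed subgroups that contain a Borel subgroup. -/
def IsParabolic (G P : Subgroup (GL (Fin N) ℂ)) : Prop :=
  P ≤ G ∧ IsZariskiClosed (P : Set (GL (Fin N) ℂ)) ∧ ∃ B, IsBorel G B ∧ B ≤ P

/-- `U` is the unipotent radical of `P`: its greatest closed connected normal subgroup consisting of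
unipotent elements. -/
def IsUnipotentRadical (P U : Subgroup (GL (Fin N) ℂ)) : Prop :=
  IsGreatest {V | IsClosedConnectedIn P V ∧ (V.subgroupOf P).Normal ∧
    ∀ u ∈ V, IsNilpotent (u.1 - 1 : Matrix (Fin N) (Fin N) ℂ)} U

/-- `L` is a Levi subgroup of `P`: a closed complement of the unipotent radical, `P = L ⋉ U`. -/
def IsLevi (P L : Subgroup (GL (Fin N) ℂ)) : Prop :=
  L ≤ P ∧ IsZariskiClosed (L : Set (GL (Fin N) ℂ)) ∧
    ∃ U, IsUnipotentRadical P U ∧ L ⊓ U = ⊥ ∧ L ⊔ U = P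

/-- A pair of opposite parabolic subgroups of `G`: the intersection is a Levi subgroup of both. -/
def IsOppositePair (G P Q : Subgroup (GL (Fin N) ℂ)) : Prop :=
  IsParabolic G P ∧ IsParabolic G Q ∧ IsLevi P (P ⊓ Q) ∧ IsLevi Q (P ⊓ Q)

/-- The Lie algebra of a closed subgroup `H` of `GL_N(ℂ)`: the velocities at the identity of curves
in `H`. -/
def lieAlg (H : Subgroup (GL (Fin N) ℂ)) : Submodule ℝ (Matrix (Fin N) (Fin N) ℂ) where
  carrier := {X | ∃ c : ℝ → GL (Fin N) ℂ, c 0 = 1 ∧ (∀ s, c s ∈ H) ∧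
    ∀ i j, HasDerivAt (fun s => (c s).1 i j) (X i j) 0}
  zero_mem' := ⟨fun _ => 1, rfl, fun _ => H.one_mem, fun i j => hasDerivAt_const _ _⟩
  add_mem' := by
    rintro X Y ⟨c, hc0, hc, hcX⟩ ⟨d, hd0, hd, hdY⟩
    refine ⟨fun s => c s * d s, by simp [hc0, hd0], fun s => H.mul_mem (hc s) (hd s),
      fun i j => ?_⟩
    have h := HasDerivAt.fun_sum (u := Finset.univ)
      (fun k (_ : k ∈ Finset.univ) => (hcX i k).mul (hdY k j))
    simpa [hc0, hd0, Matrix.mul_apply, Finset.sum_add_distrib, Matrix.one_apply] using h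
  smul_mem' := by
    rintro r X ⟨c, hc0, hc, hcX⟩
    refine ⟨fun s => c (r * s), by simp [hc0], fun s => hc _, fun i j => ?_⟩
    have h1 : HasDerivAt (fun s : ℝ => r * s) r 0 := by
      simpa using (hasDerivAt_id (0 : ℝ)).const_mul r
    have h2 : HasDerivAt (fun s => (c s).1 i j) (X i j) (r * 0) := by
      simpa using hcX i j
    exact h2.scomp (0 : ℝ) h1

/-- The adjoint action of `g ∈ G` on the Lie algebra of `G`. -/
def Ad (G : Subgroup (GL (Fin N) ℂ)) (g : G) (X : lieAlg G) : lieAlg G :=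
  ⟨g.1.1 * X.1 * (g.1⁻¹).1, by
    obtain ⟨c, hc0, hc, hcX⟩ := X.2
    refine ⟨fun s => g.1 * c s * g.1⁻¹, by simp [hc0],
      fun s => G.mul_mem (G.mul_mem g.2 (hc s)) (G.inv_mem g.2), fun i j => ?_⟩
    simp only [Units.val_mul, Matrix.mul_apply]
    exact HasDerivAt.fun_sum fun k _ =>
      (HasDerivAt.fun_sum fun l _ => (hcX l k).const_mul _).mul_const _⟩

/-- The homogeneous space `G / P`, with the quotient of the complex topology of `G`. -/
abbrev FlagSpace (G P : Subgroup (GL (Fin N) ℂ)) : Type := G ⧸ P.subgroupOf G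

/-- The stabilizer in `G` of a point of `G / P`. -/
def stab {G P : Subgroup (GL (Fin N) ℂ)} (x : FlagSpace G P) : Subgroup (GL (Fin N) ℂ) :=
  (MulAction.stabilizer G x).map G.subtype

/-- The tangent space of the homogeneous space `G / P` at `x`: the Lie algebra of `G` modulo
the Lie algebra of the stabilizer of `x`. The differential at `x` of the action of `g` is the map
`T_x → T_{g x}` induced by `Ad g`. -/
abbrev TangentFlag {G P : Subgroup (GL (Fin N) ℂ)} (x : FlagSpace G P) : Type :=
  lieAlg G ⧸ (lieAlg (stab x)).submoduleOf (lieAlg G)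

/-- The tangent vector at `x` defined by an element of the Lie algebra of `G`. -/
def TangentFlag.mk {G P : Subgroup (GL (Fin N) ℂ)} (x : FlagSpace G P) (X : lieAlg G) : TangentFlag x :=
  Submodule.Quotient.mk X

/-- A pair of points of `G / P⁺` and `G / P⁻` is transverse if it lies in the `G`-orbit of the pair
of base points. -/
def IsTransverse {G P Q : Subgroup (GL (Fin N) ℂ)} (x : FlagSpace G P) (y : FlagSpace G Q) : Prop :=
  ∃ g : G, x = g • ((1 : G) : FlagSpace G P) ∧ y = g • ((1 : G) : FlagSpace G Q)

end Algebraic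

/-! ### Representations -/

section Representations

variable {Γ : Type*} [Group Γ] {N : ℕ} {G P Q : Subgroup (GL (Fin N) ℂ)}

/-- The image of a representation is not contained in any proper parabolic subgroup. -/
def IsIrreducibleRep (ρ : Γ →* G) : Prop :=
  ∀ R : Subgroup (GL (Fin N) ℂ), IsParabolic G R → (∀ γ, (ρ γ : GL (Fin N) ℂ) ∈ R) → R = G

/-- The image of a representation is Zariski dense in `G`. -/
def IsZariskiDenseRep (ρ : Γ →* G) : Prop :=
  (G : Set (GL (Fin N) ℂ)) ⊆ zariskiClosure (Set.range fun γ => (ρ γ : GL (Fin N) ℂ))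

/-- The conjugate representation `γ ↦ g ρ(γ) g⁻¹`. -/
def conjRep (g : G) (ρ : Γ →* G) : Γ →* G := (MulAut.conj g).toMonoidHom.comp ρ

variable {S : Finset Γ} {M : Type*} [MetricSpace M] [ProperSpace M] [MulAction Γ M]

/-- A continuous and `ρ`-equivariant family of norms on the tangent spaces of `G / P` at the points
`x m`, for `m` in the flow space. Continuity is expressed in the trivial bundle
`M × Lie G`, of which the bundle of these tangent spaces is a quotient. -/
structure EquivariantNorms (ρ : Γ →* G) (x : M → FlagSpace G P) where
  nrm : ∀ m : M, Seminorm ℝ (TangentFlag (x m))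
  definite : ∀ (m : M) (v : TangentFlag (x m)), nrm m v = 0 → v = 0
  continuous : Continuous fun p : M × lieAlg G => nrm p.1 (TangentFlag.mk (x p.1) p.2)
  equivariant : ∀ (γ : Γ) (m : M) (X : lieAlg G),
    nrm (γ • m) (TangentFlag.mk (x (γ • m)) (Ad G (ρ γ) X)) = nrm m (TangentFlag.mk (x m) X)

/-- `‖e‖_{φ_{εt} m} ≤ A e^{-at} ‖e‖_m` for all `t ≥ 0`, `m` and all tangent vectors `e` at `x m`,
for a family of points `x` that is constant along the orbits of the flow. -/
def IsContracted (Φ : FlowSpace S M) (ρ : Γ →* G) (x : M → FlagSpace G P) (ε : ℝ) : Prop :=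
  ∃ ν : EquivariantNorms ρ x, ∃ A a : ℝ, 0 < A ∧ 0 < a ∧
    ∀ (t : ℝ) (m : M) (X : lieAlg G), 0 ≤ t →
      ν.nrm (Φ.flow (ε * t) m) (TangentFlag.mk (x (Φ.flow (ε * t) m)) X) ≤
        A * Real.exp (-a * t) * ν.nrm m (TangentFlag.mk (x m) X)

/-- Continuous `ρ`-equivariant maps from the boundary of `Γ` to `G / P`. -/
def IsContEquivariant (ρ : Γ →* G) (ξ : Bdry S → FlagSpace G P) : Prop :=
  Continuous ξ ∧ ∀ (γ : Γ) (t : Bdry S), ξ (γ • t) = ρ γ • ξ t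

/-- `ρ` is `(P, Q)`-Anosov with Anosov maps `ξp`, `ξm`. -/
structure IsAnosovWith (Φ : FlowSpace S M) (ρ : Γ →* G) (ξp : Bdry S → FlagSpace G P)
    (ξm : Bdry S → FlagSpace G Q) : Prop where
  contEquivariant_plus : IsContEquivariant ρ ξp
  contEquivariant_minus : IsContEquivariant ρ ξm
  transverse : ∀ t s : Bdry S, t ≠ s → IsTransverse (ξp t) (ξm s)
  contracted_plus : IsContracted Φ ρ (fun m => ξp (Φ.tauPlus m)) (-1)
  contracted_minus : IsContracted Φ ρ (fun m => ξm (Φ.tauMinus m)) 1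

/-- `ρ` is a `(P, Q)`-Anosov representation. -/
def IsAnosov (P Q : Subgroup (GL (Fin N) ℂ)) (Φ : FlowSpace S M) (ρ : Γ →* G) : Prop :=
  ∃ (ξp : Bdry S → FlagSpace G P) (ξm : Bdry S → FlagSpace G Q), IsAnosovWith Φ ρ ξp ξm

/-- A compatible pair of maps: the stabilizers of `ξp t` and `ξm t` intersect in a
parabolic subgroup, and the pair is transverse at distinct points. -/
def IsCompatible (ξp : Bdry S → FlagSpace G P) (ξm : Bdry S → FlagSpace G Q) : Prop :=
  (∀ t, IsParabolic G (stab (ξp t) ⊓ stab (ξm t))) ∧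
    ∀ t s : Bdry S, t ≠ s → IsTransverse (ξp t) (ξm s)

/-- The irreducible `(P, Q)`-Anosov representations. -/
def irreducibleAnosovReps (P Q : Subgroup (GL (Fin N) ℂ)) (Φ : FlowSpace S M) : Set (Γ →* G) :=
  {ρ | IsIrreducibleRep ρ ∧ IsAnosov P Q Φ ρ}

/-- The Zariski dense `(P, Q)`-Anosov representations. -/
def zariskiDenseAnosovReps (P Q : Subgroup (GL (Fin N) ℂ)) (Φ : FlowSpace S M) : Set (Γ →* G) :=
  {ρ | IsZariskiDenseRep ρ ∧ IsAnosov P Q Φ ρ}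

/-- `G` acts on the set `X` of representations by conjugation. -/
def ConjActsOn (X : Set (Γ →* G)) : Prop :=
  ∃ act : MulAction G X, ∀ (g : G) (ρ : X), (act.smul g ρ : Γ →* G) = conjRep g ρ

end Representations

/-! ### The group `SL_n(ℂ)` -/

section SpecialLinear

/-- `SL_n(ℂ)` as a subgroup of `GL_n(ℂ)`. -/
def SLGroup (n : ℕ) : Subgroup (GL (Fin n) ℂ) := (Matrix.GeneralLinearGroup.det).ker

/-- The stabilizer in `SL_n(ℂ)` of a linear subspace of `ℂⁿ`. -/
def stabSubspace {n : ℕ} (W : Submodule ℂ (Fin n → ℂ)) : Subgroup (GL (Fin n) ℂ) where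
  carrier := {g | g ∈ SLGroup n ∧ ∀ v, Matrix.mulVec g.1 v ∈ W ↔ v ∈ W}
  one_mem' := ⟨Subgroup.one_mem _, by simp⟩
  mul_mem' := by
    rintro g h ⟨hg, hg'⟩ ⟨hh, hh'⟩
    refine ⟨Subgroup.mul_mem _ hg hh, fun v => ?_⟩
    rw [Units.val_mul, ← Matrix.mulVec_mulVec, hg', hh']
  inv_mem' := by
    rintro g ⟨hg, hg'⟩
    refine ⟨Subgroup.inv_mem _ hg, fun v => ?_⟩
    rw [← hg', Matrix.mulVec_mulVec, ← Units.val_mul, mul_inv_cancel, Units.val_one,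
      Matrix.one_mulVec]

end SpecialLinear

end AnosovRep

end

open AnosovRep

/-! The theorem is transport of structure. Conjugation by `g` is an automorphism of `G` that
preserves Zariski closed sets (`conj_mem_zariskiClosure`), hence Borel and parabolic subgroups,
irreducibility and Zariski density. Translation by `g` is a homeomorphism of each flag space that
intertwines `ρ` with its conjugate and conjugates stabilizers (`stab_smul`), so equivariance,
transversality and compatibility carry over. The contraction property is the only analytic part.
Norms at `x m` are pulled back to `g • x m` along the differential of `g⁻¹`
(`EquivariantNorms.translate`). As `g` is fixed and the flow moves only `m`, each new inequality is
an old one with the same constants. -/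

open Pointwise

noncomputable section

namespace AnosovRep

/-! ### Conjugation of Zariski closed sets, Borel and parabolic subgroups -/

section Conjugation

variable {N : ℕ}

theorem conj_mem_zariskiClosure (g : GL (Fin N) ℂ) {A : Set (GL (Fin N) ℂ)} {h : GL (Fin N) ℂ}
    (hh : h ∈ zariskiClosure A) :
    MulAut.conj g • h ∈ zariskiClosure (MulAut.conj g • A) := by
  intro f hf
  -- `F` lists the entries of `g X g⁻¹`, linear polynomials in those of `X`. Substituting them pulls
  -- `f` back to a polynomial that vanishes on `A`.
  let F : Fin N × Fin N → MvPolynomial (Fin N × Fin N) ℂ := fun p =>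
    ∑ k, (∑ l, MvPolynomial.C (g.1 p.1 l) * MvPolynomial.X (l, k)) *
      MvPolynomial.C ((g⁻¹).1 k p.2)
  have key : ∀ a : GL (Fin N) ℂ,
      MvPolynomial.eval (fun p => a.1 p.1 p.2) (MvPolynomial.bind₁ F f) =
        MvPolynomial.eval (fun p => (MulAut.conj g • a).1 p.1 p.2) f := by
    intro a
    rw [← MvPolynomial.coe_aeval_eq_eval, RingHom.coe_coe, MvPolynomial.aeval_bind₁,
      ← MvPolynomial.coe_aeval_eq_eval, RingHom.coe_coe]
    congr 2
    funext p
    simp [F, Matrix.mul_apply, MulAut.smul_def]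
  rw [← key]
  exact hh _ fun a ha => by rw [key]; exact hf _ (Set.smul_mem_smul_set ha)

theorem IsZariskiClosed.conj {A : Set (GL (Fin N) ℂ)} (hA : IsZariskiClosed A)
    (g : GL (Fin N) ℂ) : IsZariskiClosed (MulAut.conj g • A) := by
  intro h hh
  rw [Set.mem_smul_set_iff_inv_smul_mem, ← map_inv]
  apply hA
  simpa [map_inv] using conj_mem_zariskiClosure g⁻¹ hh

theorem IsZariskiConnected.conj {H : Subgroup (GL (Fin N) ℂ)} (hH : IsZariskiConnected H)
    (g : GL (Fin N) ℂ) : IsZariskiConnected (MulAut.conj g • H) := by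
  intro A B hA hB hAB hd
  have h := hH _ _ (hA.conj g⁻¹) (hB.conj g⁻¹)
  simp only [map_inv, ← Set.smul_set_union, ← Set.smul_set_inter, Set.subset_smul_set_iff,
    inv_inv, ← Subgroup.coe_pointwise_smul] at h
  refine h hAB ?_
  rw [← smul_left_cancel_iff (MulAut.conj g), Set.smul_set_inter, smul_inv_smul,
    Set.smul_set_empty, ← Subgroup.coe_pointwise_smul, hd]

theorem IsClosedConnectedIn.conj {G H : Subgroup (GL (Fin N) ℂ)} (h : IsClosedConnectedIn G H)
    {g : GL (Fin N) ℂ} (hg : g ∈ G) : IsClosedConnectedIn G (MulAut.conj g • H) := by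
  refine ⟨?_, ?_, h.2.2.conj g⟩
  -- Since `g ∈ G`, the ambient group equals its own conjugate.
  · rw [← Subgroup.conj_smul_eq_self_of_mem hg]
    exact Subgroup.pointwise_smul_le_pointwise_smul_iff.2 h.1
  · rw [Subgroup.coe_pointwise_smul]
    exact h.2.1.conj g

theorem isSolvable_conj {H : Subgroup (GL (Fin N) ℂ)} (h : Group.IsSolvable H)
    (g : GL (Fin N) ℂ) : Group.IsSolvable (MulAut.conj g • H : Subgroup (GL (Fin N) ℂ)) :=
  Group.isSolvable_of_surjective (f := (Subgroup.equivSMul (MulAut.conj g) H).toMonoidHom)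
    (Subgroup.equivSMul (MulAut.conj g) H).surjective

/-- Maximality survives because a competitor `C` above the conjugate of `B` becomes, after
conjugation by `g⁻¹`, a competitor above `B`. -/
theorem IsBorel.conj {G B : Subgroup (GL (Fin N) ℂ)} (h : IsBorel G B)
    {g : GL (Fin N) ℂ} (hg : g ∈ G) : IsBorel G (MulAut.conj g • B) := by
  refine ⟨⟨h.1.1.conj hg, isSolvable_conj h.1.2 g⟩, fun C hC hBC => ?_⟩
  rw [Subgroup.pointwise_smul_subset_iff, ← map_inv] at hBC
  have := h.2 ⟨hC.1.conj (G.inv_mem hg), isSolvable_conj hC.2 g⁻¹⟩ hBC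
  rwa [map_inv, ← Subgroup.subset_pointwise_smul_iff] at this

theorem IsParabolic.conj {G P : Subgroup (GL (Fin N) ℂ)} (h : IsParabolic G P)
    {g : GL (Fin N) ℂ} (hg : g ∈ G) : IsParabolic G (MulAut.conj g • P) := by
  obtain ⟨hPG, hP, B, hB, hBP⟩ := h
  refine ⟨?_, ?_, MulAut.conj g • B, hB.conj hg,
    Subgroup.pointwise_smul_le_pointwise_smul_iff.2 hBP⟩
  · rw [← Subgroup.conj_smul_eq_self_of_mem hg]
    exact Subgroup.pointwise_smul_le_pointwise_smul_iff.2 hPG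
  · rw [Subgroup.coe_pointwise_smul]
    exact hP.conj g

end Conjugation

/-! ### Stabilizers and tangent spaces under translation -/

section Tangent

variable {N : ℕ} {G P : Subgroup (GL (Fin N) ℂ)}

theorem mem_stab_iff {x : FlagSpace G P} {h : GL (Fin N) ℂ} :
    h ∈ stab x ↔ ∃ hG : h ∈ G, (⟨h, hG⟩ : G) • x = x := by
  simp [stab]

/-- This identity lets `Ad g` descend to tangent spaces, and reduces compatibility of translated
maps to conjugating parabolics. -/
theorem stab_smul (g : G) (x : FlagSpace G P) :
    stab (g • x) = MulAut.conj (g : GL (Fin N) ℂ) • stab x := by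
  ext h
  rw [Subgroup.mem_pointwise_smul_iff_inv_smul_mem, ← map_inv, MulAut.smul_def,
    MulAut.conj_apply, inv_inv, mem_stab_iff, mem_stab_iff]
  constructor
  · rintro ⟨hG, hx⟩
    refine ⟨G.mul_mem (G.mul_mem (G.inv_mem g.2) hG) g.2, ?_⟩
    change (g⁻¹ * ⟨h, hG⟩ * g) • x = x
    rw [mul_smul, mul_smul, hx, inv_smul_smul]
  · rintro ⟨hG, hx⟩
    have hG' : h ∈ G := by
      simpa [mul_assoc] using G.mul_mem (G.mul_mem g.2 hG) (G.inv_mem g.2)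
    refine ⟨hG', ?_⟩
    change (g⁻¹ * ⟨h, hG'⟩ * g) • x = x at hx
    rwa [mul_smul, mul_smul, inv_smul_eq_iff] at hx

/-- The adjoint action as a linear map. -/
def adLinear (G : Subgroup (GL (Fin N) ℂ)) (g : G) : lieAlg G →ₗ[ℝ] lieAlg G where
  toFun := Ad G g
  map_add' X Y := Subtype.ext (by simp [Ad, mul_add, add_mul])
  map_smul' r X := Subtype.ext (by simp [Ad])

theorem Ad_mul (g h : G) (X : lieAlg G) : Ad G (g * h) X = Ad G g (Ad G h X) :=
  Subtype.ext (by simp [Ad, mul_assoc])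

theorem Ad_one (X : lieAlg G) : Ad G 1 X = X := Subtype.ext (by simp [Ad])

theorem continuous_Ad (g : G) : Continuous (Ad G g) :=
  Continuous.subtype_mk ((continuous_const.matrix_mul continuous_subtype_val).matrix_mul
    continuous_const) _

/-- Conjugating a curve with velocity `X` gives one with the conjugate velocity, entry by entry.
Unlike in `Ad`, the element `g` may move `H`. -/
theorem conj_mem_lieAlg {H : Subgroup (GL (Fin N) ℂ)} (g : GL (Fin N) ℂ)
    {X : Matrix (Fin N) (Fin N) ℂ} (hX : X ∈ lieAlg H) :
    g.1 * X * (g⁻¹).1 ∈ lieAlg (MulAut.conj g • H) := by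
  obtain ⟨c, hc0, hc, hcX⟩ := hX
  refine ⟨fun s => g * c s * g⁻¹, by simp [hc0],
    fun s => Subgroup.smul_mem_pointwise_smul _ (MulAut.conj g) H (hc s), fun i j => ?_⟩
  simp only [Units.val_mul, Matrix.mul_apply]
  exact HasDerivAt.fun_sum fun k _ =>
    (HasDerivAt.fun_sum fun l _ => (hcX l k).const_mul _).mul_const _

theorem Ad_mem_lieAlg_stab (g : G) (x : FlagSpace G P) {X : lieAlg G}
    (hX : X ∈ (lieAlg (stab x)).submoduleOf (lieAlg G)) :
    Ad G g X ∈ (lieAlg (stab (g • x))).submoduleOf (lieAlg G) := by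
  rw [stab_smul]
  exact conj_mem_lieAlg g.1 hX

theorem Ad_inv_mem_lieAlg_stab (g : G) (x : FlagSpace G P) {X : lieAlg G}
    (hX : X ∈ (lieAlg (stab (g • x))).submoduleOf (lieAlg G)) :
    Ad G g⁻¹ X ∈ (lieAlg (stab x)).submoduleOf (lieAlg G) := by
  simpa using Ad_mem_lieAlg_stab g⁻¹ (g • x) hX

/-- The differential at `g x` of the action of `g⁻¹`. -/
def tangentTranslateInv (g : G) (x : FlagSpace G P) : TangentFlag (g • x) →ₗ[ℝ] TangentFlag x :=
  Submodule.mapQ _ _ (adLinear G g⁻¹) fun _ hX => Ad_inv_mem_lieAlg_stab g x hX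

theorem tangentTranslateInv_mk (g : G) (x : FlagSpace G P) (X : lieAlg G) :
    tangentTranslateInv g x (TangentFlag.mk (g • x) X) = TangentFlag.mk x (Ad G g⁻¹ X) := rfl

/-- Needed so that the transported seminorms stay definite. If `Ad g⁻¹ X` is tangent to the
stabilizer of `x`, applying `Ad g` shows that `X` is tangent to that of `g • x`. -/
theorem tangentTranslateInv_injective (g : G) (x : FlagSpace G P) :
    Function.Injective (tangentTranslateInv g x) := by
  rw [injective_iff_map_eq_zero]
  intro v hv
  obtain ⟨X, rfl⟩ := Submodule.Quotient.mk_surjective _ v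
  have hX := Ad_mem_lieAlg_stab g x ((Submodule.Quotient.mk_eq_zero _).1 hv)
  refine (Submodule.Quotient.mk_eq_zero _).2 ?_
  change Ad G g (Ad G g⁻¹ X) ∈ _ at hX
  rwa [← Ad_mul, mul_inv_cancel, Ad_one] at hX

theorem IsTransverse.smul {Q : Subgroup (GL (Fin N) ℂ)} {x : FlagSpace G P} {y : FlagSpace G Q}
    (h : IsTransverse x y) (g : G) : IsTransverse (g • x) (g • y) := by
  obtain ⟨k, rfl, rfl⟩ := h
  exact ⟨g * k, (mul_smul _ _ _).symm, (mul_smul _ _ _).symm⟩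

end Tangent

/-! ### Conjugate representations and their Anosov maps -/

section Representations

variable {Γ : Type*} [Group Γ] {N : ℕ} {G P Q : Subgroup (GL (Fin N) ℂ)}

theorem conjRep_apply (g : G) (ρ : Γ →* G) (γ : Γ) : conjRep g ρ γ = g * ρ γ * g⁻¹ := rfl

theorem conjRep_one (ρ : Γ →* G) : conjRep 1 ρ = ρ := by
  ext1 γ
  simp [conjRep_apply]

theorem conjRep_mul (g h : G) (ρ : Γ →* G) : conjRep (g * h) ρ = conjRep g (conjRep h ρ) := by
  ext1 γ
  simp [conjRep_apply, mul_assoc]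

/-- The action laws hold on all homomorphisms, so invariance of `X` suffices. -/
theorem conjActsOn_of_forall_mem {X : Set (Γ →* G)}
    (hX : ∀ ρ ∈ X, ∀ g : G, conjRep g ρ ∈ X) : ConjActsOn X :=
  ⟨{ smul := fun g ρ => ⟨conjRep g ρ, hX ρ ρ.2 g⟩
     one_smul := fun _ => Subtype.ext (conjRep_one _)
     mul_smul := fun g h _ => Subtype.ext (conjRep_mul g h _) }, fun _ _ => rfl⟩

theorem IsIrreducibleRep.conjRep {ρ : Γ →* G} (hρ : IsIrreducibleRep ρ) (g : G) :
    IsIrreducibleRep (conjRep g ρ) := by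
  intro R hR hmem
  -- The parabolic `g⁻¹ R g` contains the image of `ρ`, so it is `G`; conjugating back gives `R =
  -- G`.
  have h := hρ _ (hR.conj (G.inv_mem g.2)) fun γ => by
    rw [map_inv, Subgroup.mem_inv_pointwise_smul_iff]
    exact hmem γ
  rw [map_inv, inv_smul_eq_iff, Subgroup.conj_smul_eq_self_of_mem g.2] at h
  exact h

theorem IsZariskiDenseRep.conjRep {ρ : Γ →* G} (hρ : IsZariskiDenseRep ρ) (g : G) :
    IsZariskiDenseRep (conjRep g ρ) := by
  intro h hh
  -- Density of `ρ` is applied to `g⁻¹ h g`, and the conclusion is conjugated back to `h`.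
  have hmem : (g⁻¹ : GL (Fin N) ℂ) * h * g ∈ G := G.mul_mem (G.mul_mem (G.inv_mem g.2) hh) g.2
  have key := conj_mem_zariskiClosure (g : GL (Fin N) ℂ) (hρ hmem)
  have hrange : MulAut.conj (g : GL (Fin N) ℂ) • Set.range (fun γ => (ρ γ : GL (Fin N) ℂ)) =
      Set.range fun γ => (AnosovRep.conjRep g ρ γ : GL (Fin N) ℂ) := by
    rw [← Set.image_smul, ← Set.range_comp]
    rfl
  rw [hrange] at key
  simpa [MulAut.smul_def, mul_assoc] using key

variable {S : Finset Γ} {M : Type*} [MetricSpace M] [ProperSpace M] [MulAction Γ M]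

theorem IsContEquivariant.conjRep {ρ : Γ →* G} {ξ : Bdry S → FlagSpace G P}
    (h : IsContEquivariant ρ ξ) (g : G) :
    IsContEquivariant (conjRep g ρ) (fun t => g • ξ t) := by
  refine ⟨h.1.const_smul g, fun γ t => ?_⟩
  simp only [h.2, conjRep_apply, mul_smul, inv_smul_smul]

theorem IsCompatible.smul {ξp : Bdry S → FlagSpace G P} {ξm : Bdry S → FlagSpace G Q}
    (h : IsCompatible ξp ξm) (g : G) :
    IsCompatible (fun t => g • ξp t) (fun t => g • ξm t) := by
  refine ⟨fun t => ?_, fun t s hts => (h.2 t s hts).smul g⟩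
  simp only [stab_smul, ← Subgroup.smul_inf]
  exact (h.1 t).conj g.2

/-- The family of norms on the tangent spaces at the points `g x(m)` transported from the tangent
spaces at `x(m)` by the action of `g`. -/
def EquivariantNorms.translate {ρ : Γ →* G} {x : M → FlagSpace G P} (ν : EquivariantNorms ρ x)
    (g : G) : EquivariantNorms (conjRep g ρ) (fun m => g • x m) where
  nrm m := (ν.nrm m).comp (tangentTranslateInv g (x m))
  definite m v hv := by
    refine tangentTranslateInv_injective g (x m) ?_
    rw [map_zero]
    exact ν.definite m _ hv
  continuous := by
    have h : Continuous fun p : M × lieAlg G => (p.1, Ad G g⁻¹ p.2) :=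
      continuous_fst.prodMk ((continuous_Ad g⁻¹).comp continuous_snd)
    simp only [Seminorm.comp_apply, tangentTranslateInv_mk]
    exact ν.continuous.comp h
  equivariant γ m X := by
    simp only [Seminorm.comp_apply, tangentTranslateInv_mk]
    -- The factors cancel: `g⁻¹ (g ρ(γ) g⁻¹) = ρ(γ) g⁻¹`.
    rw [← ν.equivariant γ m (Ad G g⁻¹ X), conjRep_apply, ← Ad_mul, ← Ad_mul]
    simp [mul_assoc]

theorem IsContracted.conjRep {Φ : FlowSpace S M} {ρ : Γ →* G} {x : M → FlagSpace G P} {ε : ℝ}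
    (h : IsContracted Φ ρ x ε) (g : G) :
    IsContracted Φ (conjRep g ρ) (fun m => g • x m) ε := by
  obtain ⟨ν, A, a, hA, ha, hν⟩ := h
  -- The representative `Ad g⁻¹ X` is the same at `m` and at the flowed point, so the old estimate
  -- applies to it unchanged.
  exact ⟨ν.translate g, A, a, hA, ha, fun t m X ht => hν t m (Ad G g⁻¹ X) ht⟩

theorem IsAnosovWith.conjRep {Φ : FlowSpace S M} {ρ : Γ →* G} {ξp : Bdry S → FlagSpace G P}
    {ξm : Bdry S → FlagSpace G Q} (h : IsAnosovWith Φ ρ ξp ξm) (g : G) :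
    IsAnosovWith Φ (conjRep g ρ) (fun t => g • ξp t) (fun t => g • ξm t) where
  contEquivariant_plus := h.contEquivariant_plus.conjRep g
  contEquivariant_minus := h.contEquivariant_minus.conjRep g
  transverse t s hts := (h.transverse t s hts).smul g
  contracted_plus := h.contracted_plus.conjRep g
  contracted_minus := h.contracted_minus.conjRep g

theorem IsAnosov.conjRep {Φ : FlowSpace S M} {ρ : Γ →* G} (h : IsAnosov P Q Φ ρ) (g : G) :
    IsAnosov P Q Φ (conjRep g ρ) := by
  obtain ⟨ξp, ξm, h⟩ := h
  exact ⟨_, _, h.conjRep g⟩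

end Representations

end AnosovRep

end

theorem proposition1p5
    {Γ : Type*} [Group Γ] (S : Finset Γ) (hS : IsHyperbolicGroup S)
    {M : Type*} [MetricSpace M] [ProperSpace M] [MulAction Γ M] (Φ : FlowSpace S M) :
    -- irreducible Anosov representations into `SL_n(ℂ)`
    (∀ (n : ℕ), 2 ≤ n → ∀ (D H : Submodule ℂ (Fin n → ℂ)), Module.finrank ℂ D = 1 → IsCompl D H →
      (∀ (ρ : Γ →* SLGroup n) (ξp : Bdry S → FlagSpace (SLGroup n) (stabSubspace D))
          (ξm : Bdry S → FlagSpace (SLGroup n) (stabSubspace H)),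
        IsIrreducibleRep ρ → IsAnosovWith Φ ρ ξp ξm → ∀ g : SLGroup n,
          IsIrreducibleRep (conjRep g ρ) ∧
          IsAnosovWith Φ (conjRep g ρ) (fun t => g • ξp t) (fun t => g • ξm t)) ∧
      ConjActsOn (G := SLGroup n) (irreducibleAnosovReps (stabSubspace D) (stabSubspace H) Φ)) ∧
    -- representations into connected semisimple groups
    (∀ (N : ℕ) (G P Q : Subgroup (GL (Fin N) ℂ)), IsConnectedSemisimple G → IsOppositePair G P Q →
      (∀ (ρ : Γ →* G) (ξp : Bdry S → FlagSpace G P) (ξm : Bdry S → FlagSpace G Q),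
        IsAnosovWith Φ ρ ξp ξm → ∀ g : G,
          IsContEquivariant (conjRep g ρ) (fun t => g • ξp t) ∧
          IsContEquivariant (conjRep g ρ) (fun t => g • ξm t) ∧
          (∀ t s : Bdry S, t ≠ s → IsTransverse (g • ξp t) (g • ξm s)) ∧
          (IsCompatible ξp ξm → IsCompatible (fun t => g • ξp t) (fun t => g • ξm t))) ∧
      (∀ (ρ : Γ →* G) (ξp : Bdry S → FlagSpace G P) (ξm : Bdry S → FlagSpace G Q),
        IsZariskiDenseRep ρ → IsAnosovWith Φ ρ ξp ξm → ∀ g : G,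
          IsZariskiDenseRep (conjRep g ρ) ∧
          IsAnosovWith Φ (conjRep g ρ) (fun t => g • ξp t) (fun t => g • ξm t)) ∧
      ConjActsOn (G := G) (zariskiDenseAnosovReps P Q Φ)) := by
  -- Both halves use the same transport lemmas, with `SLGroup n` in the role of `G` in the first.
  refine ⟨fun n _ D H _ _ => ⟨fun ρ ξp ξm hirr hA g => ⟨hirr.conjRep g, hA.conjRep g⟩,
      conjActsOn_of_forall_mem fun ρ hρ g => ⟨hρ.1.conjRep g, hρ.2.conjRep g⟩⟩,
    fun N G P Q _ _ => ⟨fun ρ ξp ξm hA g => ⟨hA.contEquivariant_plus.conjRep g,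
        hA.contEquivariant_minus.conjRep g, fun t s hts => (hA.transverse t s hts).smul g,
        fun hc => hc.smul g⟩,
      fun ρ ξp ξm hd hA g => ⟨hd.conjRep g, hA.conjRep g⟩,
      conjActsOn_of_forall_mem fun ρ hρ g => ⟨hρ.1.conjRep g, hρ.2.conjRep g⟩⟩⟩
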